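/- Let $K$ be a field. A simplicial complex $\Delta$ on a finite vertex set $V$ is a collection of subsets of $V$ (faces) closed under taking subsets; vertices need not be faces, and $\Delta=\emptyset$ is allowed. Let $S=K[x_v : v\in V]$. The Stanley–Reisner ideal is $I_\Delta=\left(\prod_{v\in N}x_v : N\subseteq V,\ N\notin\Delta\right)\subseteq S$. For an ideal $I\subseteq S$ let $T^1(S/I)$ be the cokernel of the map $\operatorname{Der}_K(S)\to\operatorname{Hom}_S(I,S/I)$, $\partial\mapsto(f\mapsto \partial f+I)$. The complex $\Delta$ is called rigid (with respect to $K$) if $T^1(S/I_\Delta)=0$. For $F\in\Delta$, $\operatorname{link}_\Delta F=\{G\in\Delta : G\cap F=\emptyset,\ G\cup F\in\Delta\}$, a complex on the vertex set $V\setminus F$. A complex on a vertex set $W$ is called special if either its only facet is $W\setminus\{i\}$ for some $i\in W$, or it has exactly two facets, namely $\{i\}$ and $W\setminus\{i\}$ for some $i\in W$. For $F\subseteq V$ let $P_F=(x_v : v\in F)$; these are the monomial prime ideals of $S$. The monomial localization of a monomial ideal $I$ with respect to $P_F$ is the ideal $I(P_F)\subseteq K[x_v : v\in F]$ obtained from $I$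 by the substitution $x_v\mapsto 1$ for $v\notin F$. Let $\Delta_1,\Delta_2$ be simplicial complexes on disjoint finite vertex sets $V_1,V_2$, put $S_j=K[x_v : v\in V_j]$ and $S=K[x_v : v\in V_1\cup V_2]$, and let $\Delta_1\circ\Delta_2$ be the complex on $V_1\cup V_2$ whose faces are the sets $F\subseteq V_1\cup V_2$ with $F\cap V_1\in\Delta_1$ or $F\cap V_2\in\Delta_2$. Theorem. One has $I_{\Delta_1\circ\Delta_2}=I_{\Delta_1}I_{\Delta_2}S$, and the following hold. (a) If $\Delta_1\circ\Delta_2$ is rigid, $I_{\Delta_1}\neq0$ and $I_{\Delta_2}\neq 0$, then $\Delta_1$ and $\Delta_2$ are rigid. (b) Suppose that $\Delta_1$ and $\Delta_2$ are rigid. Then $\Delta_1\circ\Delta_2$ is rigid if and only if, for $j=1$ or $j=2$, $\operatorname{link}_{\Delta_j}F$ is not special for all $F\in\Delta_j$. Moreover, for each $j\in\{1,2\}$, the condition that no link $\operatorname{link}_{\Delta_j}F$ with $F\in\Delta_j$ is special is equivalent to the following algebraic condition: no monomial localization of $I_{\Delta_j}$ (extended to $S_j$) is of the form $zP$, where $z\in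 S_j$ is a variable and $P$ is either a nonzero monomial prime ideal of $S_j$ with $z\notin P$, or $P=S_j$. Hence $\Delta_1\circ\Delta_2$ is rigid if and only if this algebraic condition holds for $j=1$ or $j=2$. -/

import Mathlib

open MvPolynomial

/-! ## Infinitesimal deformations: the first cotangent functor -/

section Cotangent

variable (K : Type*) {S : Type*} [CommRing K] [CommRing S] [Algebra K S]

/-- The natural `S`-linear map `δ* : Der_K(S) → Hom_S(I, S/I)`, `δ*(∂)(f) = ∂f + I`. -/
def deltaStar (I : Ideal S) : Derivation K S S →ₗ[S] (I →ₗ[S] S ⧸ I) where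
  toFun D :=
    { toFun := fun f => Ideal.Quotient.mk I (D (f : S))
      map_add' := fun f g => by simp
      map_smul' := fun s f => by
        have hf : Ideal.Quotient.mk I (f : S) = 0 := Ideal.Quotient.eq_zero_iff_mem.mpr f.2
        simp [Derivation.leibniz, Algebra.smul_def, hf] }
  map_add' D E := by ext f; simp
  map_smul' s D := by ext f; simp [Algebra.smul_def]

/-- `T¹(S/I)`, the cokernel of `δ* : Der_K(S) → Hom_S(I, S/I)`
(for `S` a polynomial ring over `K`). -/
abbrev CotangentT1 (I : Ideal S) : Type _ :=
  (I →ₗ[S] S ⧸ I) ⧸ LinearMap.range (deltaStar K I)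

/-- The `K`-algebra `S/I` (`S` a polynomial ring over `K`) is rigid: `T¹(S/I) = 0`. -/
def IsRigidIdeal (I : Ideal S) : Prop :=
  Subsingleton (CotangentT1 K I)

end Cotangent

/-! ## Simplicial complexes -/

/-- A simplicial complex on the vertex set `V`: a collection of subsets of `V` closed under passing
to subsets. The complex without faces and the complex `{∅}` are allowed, and a vertex need not
be a face. -/
abbrev SimplComplex (V : Type*) : Type _ := LowerSet (Finset V)

namespace SimplComplex

/-- A facet is a face that is maximal with respect to inclusion. -/
def facets {V : Type*} (Δ : SimplComplex V) : Set (Finset V) :=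
  {F | Maximal (fun G => G ∈ Δ) F}

/-- The link of `A` in `Δ`, a complex on the vertex set `V \ A`: its faces are the `G` disjoint
from `A` with `G ∪ A ∈ Δ` (so also `G ∈ Δ`). -/
def link {V : Type*} [DecidableEq V] (Δ : SimplComplex V) (A : Finset V) :
    SimplComplex {v : V // v ∉ A} where
  carrier := {G | G.map (Function.Embedding.subtype _) ∪ A ∈ Δ}
  lower' _ _ hHG hG :=
    Δ.lower (Finset.union_subset_union (Finset.map_subset_map.mpr hHG) (Finset.Subset.refl A)) hG

/-- The circ `Δ₁ ∘ Δ₂` on the disjoint union of the vertex sets: `F` is a face iff `F ∩ V₁ ∈ Δ₁`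
or `F ∩ V₂ ∈ Δ₂`. -/
def circ {V₁ V₂ : Type*} (Δ₁ : SimplComplex V₁) (Δ₂ : SimplComplex V₂) :
    SimplComplex (V₁ ⊕ V₂) where
  carrier := {F | F.toLeft ∈ Δ₁ ∨ F.toRight ∈ Δ₂}
  lower' _ _ hHG hG :=
    hG.imp (fun h => Δ₁.lower (Finset.toLeft_subset_toLeft hHG) h)
      (fun h => Δ₂.lower (Finset.toRight_subset_toRight hHG) h)

/-- `Δ` on the vertex set `V` is special: either its unique facet is `V \ {i}` for some vertex `i`,
or it has exactly two facets, `{i}` and `V \ {i}`, for some vertex `i`. -/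
def IsSpecial {V : Type*} [Fintype V] [DecidableEq V] (Δ : SimplComplex V) : Prop :=
  (∃ i : V, Δ.facets = {({i} : Finset V)ᶜ}) ∨
    (∃ i : V, Δ.facets = {({i} : Finset V), ({i} : Finset V)ᶜ})

/-- The Stanley-Reisner ideal `I_Δ ⊆ K[x_v : v ∈ V]`, generated by the `x_N`, `N` a non-face. -/
noncomputable def stanleyReisnerIdeal (K : Type*) [Field K] {V : Type*} (Δ : SimplComplex V) :
    Ideal (MvPolynomial V K) :=
  Ideal.span {f | ∃ N : Finset V, N ∉ Δ ∧ f = ∏ v ∈ N, X v}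

/-- `Δ` is (algebraically) rigid with respect to `K`: `K[Δ] = K[x_v : v ∈ V]/I_Δ` is rigid. -/
def IsRigid (K : Type*) [Field K] {V : Type*} (Δ : SimplComplex V) : Prop :=
  IsRigidIdeal K (Δ.stanleyReisnerIdeal K)

end SimplComplex

/-! ## Monomial prime ideals and monomial localization -/

section MonomialIdeals

variable {K : Type*} [Field K] {V : Type*}

/-- The monomial prime ideals of `K[x_v : v ∈ V]` are the ideals `P_F = (x_v : v ∈ F)`. -/
noncomputable def monomialPrime (K : Type*) [Field K] {V : Type*} (F : Finset V) :
    Ideal (MvPolynomial V K) :=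
  Ideal.span ((fun v => (X v : MvPolynomial V K)) '' (F : Set V))

/-- The monomial localization `I(P_F) ⊆ S(P_F) = K[x_v : v ∈ F]` of `I` with respect to `P_F`,
obtained by the substitution `x_v ↦ 1` for `v ∉ F`. -/
noncomputable def monomialLocalization [DecidableEq V] (I : Ideal (MvPolynomial V K))
    (F : Finset V) : Ideal (MvPolynomial {v : V // v ∈ F} K) :=
  I.map (aeval (fun v : V => if h : v ∈ F then (X ⟨v, h⟩ : MvPolynomial {v : V // v ∈ F} K) else 1))

/-- The ideal `J` of `S = K[x_v : v ∈ V]` has the form `z P`, where `z` is a variable and `P` is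
either a nonzero monomial prime ideal with `z ∉ P`, or `P = S`. -/
def IsVariableTimesPrime (J : Ideal (MvPolynomial V K)) : Prop :=
  ∃ (z : V) (P : Ideal (MvPolynomial V K)),
    ((∃ F : Finset V, F.Nonempty ∧ P = monomialPrime K F) ∧ X z ∉ P ∨ P = ⊤) ∧
      J = Ideal.span {X z} * P

/-- Some monomial localization of `I` has the form `z P` of `IsVariableTimesPrime`, after
extension along the inclusion `S(P_F) ⊆ S`. -/
def HasSpecialLocalization [DecidableEq V] (I : Ideal (MvPolynomial V K)) : Prop :=
  ∃ F : Finset V, IsVariableTimesPrime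
    ((monomialLocalization I F).map
      (rename (fun v : {v : V // v ∈ F} => (v : V)) :
        MvPolynomial {v : V // v ∈ F} K →ₐ[K] MvPolynomial V K))

end MonomialIdeals

/-! ## Squarefree monomials and the Stanley-Reisner ideal -/

/-! `Hom_S(I_Δ, S/I_Δ)` is graded by multidegrees `A - b`, with `A` an exponent vector and `b` a set
disjoint from its support `a`. A homomorphism of this degree sends `x_{G ∪ b}` to `l(G) x_G x^A`.
Only the sets with `G ∪ b ∉ Δ` and `G ∪ a ∈ Δ` matter: the first monomial must lie in `I_Δ`, the
second must survive in `S/I_Δ`. Linearity makes `l` constant along inclusions, and `l(G) = 0` if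
already `G ∪ b' ∉ Δ` for some `b' ⊂ b`, since the value is then divisible by `x_{b \ b'}`.
Derivations `x^A ∂_i` account exactly for the constant `l` with `b = {i}`. So rigidity is
combinatorial and depends on `A` only through `a`: `l` must vanish for `|b| > 1` and be constant for
`|b| = 1` (`isRigid_iff`).

For a circ everything splits into pairs. With `b₂ = ∅` the condition is that of `Δ₁`, whence (a).
With `b₁`, `b₂` both nonempty, rigidity of the factors forces the cocycle to vanish unless `b₁ =
{i}`, `b₂ = {j}` and both `{i}ᶜ`, `{j}ᶜ` are facets; in that case `x_i x_j f ↦ f` is a genuine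
obstruction (`isRigid_circ_iff_of_isRigid`). Having a facet `{i}ᶜ` means `0 ≠ I_Δ ⊆ (x_i)`, and this
is what special links and special localizations both detect. -/

/-- The exponent vector of the squarefree monomial `x_N`. -/
noncomputable def squarefreeExponent {V : Type*} (N : Finset V) : V →₀ ℕ :=
  Finsupp.indicator N fun _ _ => 1

section SquarefreeExponent

variable {V : Type*} [DecidableEq V]

@[simp] lemma squarefreeExponent_apply (N : Finset V) (v : V) :
    squarefreeExponent N v = if v ∈ N then 1 else 0 := by
  simp [squarefreeExponent, Finsupp.indicator_apply]

@[simp] lemma support_squarefreeExponent (N : Finset V) : (squarefreeExponent N).support = N := by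
  ext v
  simp

lemma squarefreeExponent_le_iff (N : Finset V) (m : V →₀ ℕ) :
    squarefreeExponent N ≤ m ↔ N ⊆ m.support := by
  constructor
  · intro h v hv
    have := h v
    simp only [squarefreeExponent_apply, hv, if_true] at this
    simp only [Finsupp.mem_support_iff]
    omega
  · intro h v
    by_cases hv : v ∈ N
    · have := h hv
      simp only [Finsupp.mem_support_iff] at this
      simp only [squarefreeExponent_apply, hv, if_true]
      omega
    · simp [hv]

lemma squarefreeExponent_sub_single (N : Finset V) (v : V) :
    squarefreeExponent N - Finsupp.single v 1 = squarefreeExponent (N.erase v) := by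
  ext w
  by_cases h : w = v
  · subst h
    by_cases hN : w ∈ N <;> simp [hN]
  · simp [h]

lemma squarefreeExponent_union {A B : Finset V} (h : Disjoint A B) :
    squarefreeExponent (A ∪ B) = squarefreeExponent A + squarefreeExponent B := by
  ext v
  by_cases hA : v ∈ A
  · simp [hA, Finset.disjoint_left.mp h hA]
  · simp [hA]

lemma support_squarefreeExponent_add (G : Finset V) (A : V →₀ ℕ) :
    (squarefreeExponent G + A).support = G ∪ A.support := by
  ext v
  by_cases hv : v ∈ G <;> simp [hv]

omit [DecidableEq V] in
lemma monomial_squarefreeExponent (K : Type*) [CommSemiring K] (N : Finset V) :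
    monomial (squarefreeExponent N) (1 : K) = ∏ v ∈ N, X v := by
  classical
  rw [monomial_eq, Finsupp.prod, support_squarefreeExponent]
  simp only [map_one, one_mul]
  exact Finset.prod_congr rfl fun v hv => by simp [hv]

end SquarefreeExponent

namespace SimplComplex

section StanleyReisner

variable {K : Type*} [Field K] {V : Type*} {Δ : SimplComplex V}

lemma prod_X_mem_stanleyReisnerIdeal {N : Finset V} (hN : N ∉ Δ) :
    (∏ v ∈ N, X v : MvPolynomial V K) ∈ Δ.stanleyReisnerIdeal K :=
  Ideal.subset_span ⟨N, hN, rfl⟩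

lemma mem_stanleyReisnerIdeal_iff {f : MvPolynomial V K} :
    f ∈ Δ.stanleyReisnerIdeal K ↔ ∀ m ∈ f.support, m.support ∉ Δ := by
  classical
  have h : Δ.stanleyReisnerIdeal K = Ideal.span
      ((fun s => monomial s (1 : K)) '' (squarefreeExponent '' {N : Finset V | N ∉ Δ})) := by
    rw [stanleyReisnerIdeal]
    congr 1
    ext f
    simp only [Set.mem_ofPred_eq, Set.mem_image, exists_exists_and_eq_and,
      monomial_squarefreeExponent]
    exact ⟨fun ⟨N, h, e⟩ => ⟨N, h, e.symm⟩, fun ⟨N, h, e⟩ => ⟨N, h, e.symm⟩⟩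
  rw [h, mem_ideal_span_monomial_image]
  refine forall₂_congr fun m _ => ⟨?_, fun hm => ⟨squarefreeExponent m.support, ⟨_, hm, rfl⟩, ?_⟩⟩
  · rintro ⟨_, ⟨N, hN, rfl⟩, hle⟩ hm
    exact hN (Δ.lower ((squarefreeExponent_le_iff N m).mp hle) hm)
  · exact (squarefreeExponent_le_iff _ _).mpr subset_rfl

lemma monomial_mem_stanleyReisnerIdeal {m : V →₀ ℕ} (hm : m.support ∉ Δ) (r : K) :
    monomial m r ∈ Δ.stanleyReisnerIdeal K := by
  rw [mem_stanleyReisnerIdeal_iff]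
  intro m' hm'
  rwa [Finset.mem_singleton.mp (support_monomial_subset hm')]

/-- The coefficients at monomials supported on faces are well defined modulo `I_Δ`. -/
lemma mk_eq_mk_iff {f g : MvPolynomial V K} :
    Ideal.Quotient.mk (Δ.stanleyReisnerIdeal K) f = Ideal.Quotient.mk (Δ.stanleyReisnerIdeal K) g ↔
      ∀ m : V →₀ ℕ, m.support ∈ Δ → coeff m f = coeff m g := by
  rw [Ideal.Quotient.mk_eq_mk_iff_sub_mem, mem_stanleyReisnerIdeal_iff]
  refine forall_congr' fun m => ?_
  rw [mem_support_iff, coeff_sub, sub_ne_zero]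
  tauto

/-! ## A combinatorial criterion for rigidity -/

section Criterion

variable [DecidableEq V]

/-- For `a, b ⊆ V`, the sets `G` such that a homomorphism `I_Δ → S/I_Δ` of multidegree `a - b` can
be nonzero on the generator `x_{G ∪ b}`. -/
def IsSlice (Δ : SimplComplex V) (a b G : Finset V) : Prop :=
  Disjoint G b ∧ G ∪ a ∈ Δ ∧ G ∪ b ∉ Δ

/-- The functions that are the coefficients of a homomorphism `I_Δ → S/I_Δ` of multidegree
`a - b`. -/
structure IsCocycle (Δ : SimplComplex V) (a b : Finset V) (l : Finset V → K) : Prop where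
  mono : ∀ G G', IsSlice Δ a b G → IsSlice Δ a b G' → G ⊆ G' → l G = l G'
  boundary : ∀ G b', IsSlice Δ a b G → b' ⊂ b → G ∪ b' ∉ Δ → l G = 0

/-- Every homomorphism of multidegree `a - b` comes from a derivation. -/
def IsRigidAt (K : Type*) [Field K] (Δ : SimplComplex V) (a b : Finset V) : Prop :=
  ∀ l : Finset V → K, IsCocycle Δ a b l →
    (1 < b.card → ∀ G, IsSlice Δ a b G → l G = 0) ∧
    (b.card = 1 → ∀ G G', IsSlice Δ a b G → IsSlice Δ a b G' → l G = l G')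

end Criterion

/-- A `K`-linear endomorphism of `S` which is multiplicative modulo `I_Δ` on the monomials of
`I_Δ` induces an `S`-linear map `I_Δ → S/I_Δ`. -/
lemma exists_hom_of_monomial (ψ : MvPolynomial V K →ₗ[K] MvPolynomial V K)
    (h : ∀ n m : V →₀ ℕ, m.support ∉ Δ →
      Ideal.Quotient.mk (Δ.stanleyReisnerIdeal K) (ψ (monomial (n + m) 1)) =
        Ideal.Quotient.mk (Δ.stanleyReisnerIdeal K) (monomial n 1 * ψ (monomial m 1))) :
    ∃ φ : Δ.stanleyReisnerIdeal K →ₗ[MvPolynomial V K] _ ⧸ Δ.stanleyReisnerIdeal K,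
      ∀ f, φ f = Ideal.Quotient.mk (Δ.stanleyReisnerIdeal K) (ψ f) := by
  have hmon : ∀ (n m : V →₀ ℕ) (r c : K), m.support ∉ Δ →
      ψ (monomial n r * monomial m c) - monomial n r * ψ (monomial m c) ∈
        Δ.stanleyReisnerIdeal K := by
    intro n m r c hm
    have e1 : ∀ (k : V →₀ ℕ) (t : K), (monomial k t : MvPolynomial V K) = t • monomial k 1 := by
      intro k t
      simp [smul_monomial]
    have := Ideal.mul_mem_left _ (C (r * c))
      ((Ideal.Quotient.mk_eq_mk_iff_sub_mem _ _).mp (h n m hm))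
    convert this using 1
    rw [monomial_mul, e1 (n + m), e1 n, e1 m]
    simp only [map_smul]
    simp only [smul_eq_C_mul, map_mul]
    ring
  have hmul : ∀ (s : MvPolynomial V K) (f : Δ.stanleyReisnerIdeal K),
      ψ (s * f) - s * ψ f ∈ Δ.stanleyReisnerIdeal K := by
    intro s f
    have hf := mem_stanleyReisnerIdeal_iff.mp f.2
    rw [(f : MvPolynomial V K).as_sum, s.as_sum]
    simp only [Finset.sum_mul_sum, map_sum]
    rw [← Finset.sum_sub_distrib]
    refine Ideal.sum_mem _ fun n _ => ?_
    rw [← Finset.sum_sub_distrib]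
    exact Ideal.sum_mem _ fun m hm => hmon _ _ _ _ (hf m hm)
  refine ⟨{ toFun := fun f => Ideal.Quotient.mk _ (ψ f), map_add' := ?_, map_smul' := ?_ },
    fun _ => rfl⟩
  · intro f g
    simp
  · intro s f
    exact (Ideal.Quotient.mk_eq_mk_iff_sub_mem _ _).mpr (hmul s f)

variable [DecidableEq V]

omit [DecidableEq V] in
lemma isRigidIdeal_iff {I : Ideal (MvPolynomial V K)} :
    IsRigidIdeal K I ↔ ∀ φ : I →ₗ[MvPolynomial V K] _ ⧸ I, ∃ D, deltaStar K I D = φ := by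
  rw [IsRigidIdeal, Submodule.Quotient.subsingleton_iff, LinearMap.range_eq_top]
  rfl

/-- The value of a derivation on a squarefree monomial. -/
lemma derivation_squarefree (D : Derivation K (MvPolynomial V K) (MvPolynomial V K))
    (N : Finset V) :
    D (monomial (squarefreeExponent N) 1) =
      ∑ v ∈ N, monomial (squarefreeExponent (N.erase v)) 1 * D (X v) := by
  have hD : D = mkDerivation K fun v => D (X v) := derivation_ext fun v => by simp
  conv_lhs => rw [hD]
  rw [mkDerivation_monomial, one_smul, Finsupp.sum, support_squarefreeExponent]
  refine Finset.sum_congr rfl fun v hv => ?_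
  rw [squarefreeExponent_sub_single, smul_eq_mul]
  simp [hv]

lemma coeff_derivation_squarefree (D : Derivation K (MvPolynomial V K) (MvPolynomial V K))
    (N : Finset V) (m : V →₀ ℕ) :
    coeff m (D (monomial (squarefreeExponent N) 1)) =
      ∑ v ∈ N, if N.erase v ⊆ m.support then
        coeff (m - squarefreeExponent (N.erase v)) (D (X v)) else 0 := by
  rw [derivation_squarefree, coeff_sum]
  simp only [coeff_monomial_mul', squarefreeExponent_le_iff, one_mul]

/-- The homomorphism of multidegree `a - b` defined by a cocycle. -/
lemma exists_hom_of_isCocycle {a b : Finset V} {l : Finset V → K} (hl : IsCocycle Δ a b l) :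
    ∃ φ : Δ.stanleyReisnerIdeal K →ₗ[MvPolynomial V K] _ ⧸ Δ.stanleyReisnerIdeal K,
      ∀ f : Δ.stanleyReisnerIdeal K, ∀ G, IsSlice Δ a b G →
        (f : MvPolynomial V K) = monomial (squarefreeExponent (G ∪ b)) 1 →
        φ f = Ideal.Quotient.mk _
          (monomial (squarefreeExponent G + squarefreeExponent a) (l G)) := by
  -- Multiplication by `x^(a-b)`, scaled by `l` at the part of the support outside `b`.
  let ψ : MvPolynomial V K →ₗ[K] MvPolynomial V K := (basisMonomials V K).constr K fun m =>
    if b ⊆ m.support then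
      monomial (m - squarefreeExponent b + squarefreeExponent a) (l (m.support \ b)) else 0
  have hψ : ∀ m : V →₀ ℕ, ψ (monomial m 1) = if b ⊆ m.support then
      monomial (m - squarefreeExponent b + squarefreeExponent a) (l (m.support \ b)) else 0 := by
    intro m
    exact (basisMonomials V K).constr_basis K _ m
  have hslice : ∀ n m : V →₀ ℕ, m.support ∉ Δ → b ⊆ m.support →
      (n + m - squarefreeExponent b + squarefreeExponent a).support ∈ Δ →
      IsSlice Δ a b (m.support \ b) := by
    intro n m hm hb hΔ
    refine ⟨Finset.sdiff_disjoint, Δ.lower ?_ hΔ, ?_⟩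
    · intro v hv
      simp only [Finset.mem_union, Finset.mem_sdiff, Finsupp.mem_support_iff] at hv
      simp only [Finsupp.mem_support_iff, Finsupp.add_apply, Finsupp.tsub_apply,
        squarefreeExponent_apply]
      rcases hv with ⟨h1, h2⟩ | h
      · simp [h1, h2]
      · simp [h]
    · rwa [Finset.sdiff_union_of_subset hb]
  obtain ⟨φ, hφ⟩ := exists_hom_of_monomial (Δ := Δ) ψ <| by
    intro n m hm
    rw [mk_eq_mk_iff, hψ, hψ]
    intro k hk
    have hsup : (n + m).support = n.support ∪ m.support := by ext v; simp; tauto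
    by_cases hb : b ⊆ m.support
    · have hb' : b ⊆ (n + m).support := hsup ▸ hb.trans Finset.subset_union_right
      have e : n + (m - squarefreeExponent b + squarefreeExponent a) =
          n + m - squarefreeExponent b + squarefreeExponent a := by
        rw [← add_assoc, add_tsub_assoc_of_le ((squarefreeExponent_le_iff _ _).mpr hb)]
      rw [if_pos hb, if_pos hb', monomial_mul, one_mul, e, coeff_monomial, coeff_monomial]
      split_ifs with hke
      · subst hke
        have h2 := hslice n m hm hb hk
        have h1 := hslice 0 (n + m) (fun h => hm (Δ.lower (hsup ▸ Finset.subset_union_right) h)) hb'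
          (by rwa [zero_add])
        refine (hl.mono _ _ h2 h1 ?_).symm
        exact Finset.sdiff_subset_sdiff (hsup ▸ Finset.subset_union_right) subset_rfl
      · rfl
    · rw [if_neg hb, mul_zero, coeff_zero]
      split_ifs with hb'
      · rw [coeff_monomial]
        split_ifs with hke
        · subst hke
          have h1 := hslice 0 (n + m) (fun h => hm (Δ.lower (hsup ▸ Finset.subset_union_right) h))
            hb' (by rwa [zero_add])
          -- Here `x^m` is sent to `0` but its multiple `x^(n+m)` need not be. The part `b ∩ supp m`
          -- is proper in `b`, and joined to `supp (n+m) \ b` it still contains the non-face `supp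
          -- m`.
          refine hl.boundary _ (b ∩ m.support) h1 ?_ fun h => hm (Δ.lower ?_ h)
          · refine Finset.ssubset_iff_subset_ne.mpr ⟨Finset.inter_subset_left, fun h => hb ?_⟩
            exact Finset.inter_eq_left.mp h
          · intro v hv
            rw [hsup]
            simp only [Finset.mem_union, Finset.mem_sdiff, Finset.mem_inter]
            tauto
        · rfl
      · rw [coeff_zero]
  refine ⟨φ, fun f G hG hf => ?_⟩
  rw [hφ, hf, hψ, support_squarefreeExponent, if_pos Finset.subset_union_right,
    squarefreeExponent_union hG.1, add_tsub_cancel_right, Finset.union_sdiff_right,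
    Finset.sdiff_eq_self_of_disjoint hG.1]

/-- The coefficient of `x_G x_a` in `D x_{G ∪ b}` gets a contribution from `v` only if `(G ∪ b) \
{v} ⊆ G ∪ a`. As `b` is disjoint from `G` and `a`, this forces `b ⊆ {v}`: nothing survives for `|b|
> 1`, and for `b = {i}` only the coefficient of `x_a` in `D x_i`, which does not involve `G`. -/
lemma IsRigid.isRigidAt (h : Δ.IsRigid K) {a b : Finset V} (hab : Disjoint a b) :
    IsRigidAt K Δ a b := by
  intro l hl
  obtain ⟨φ, hφ⟩ := exists_hom_of_isCocycle hl
  obtain ⟨D, rfl⟩ := isRigidIdeal_iff.mp h φ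
  have key : ∀ G, IsSlice Δ a b G → l G = ∑ v ∈ G ∪ b, if (G ∪ b).erase v ⊆ G ∪ a then
      coeff (squarefreeExponent G + squarefreeExponent a - squarefreeExponent ((G ∪ b).erase v))
        (D (X v)) else 0 := by
    intro G hG
    have := hφ ⟨_, monomial_mem_stanleyReisnerIdeal (by simpa using hG.2.2) 1⟩ G hG rfl
    rw [deltaStar] at this
    have := mk_eq_mk_iff.mp this (squarefreeExponent G + squarefreeExponent a)
      (by simpa [support_squarefreeExponent_add] using hG.2.1)
    rw [coeff_derivation_squarefree, coeff_monomial, if_pos rfl, support_squarefreeExponent_add,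
      support_squarefreeExponent] at this
    exact this.symm
  constructor
  · intro hb G hG
    rw [key G hG]
    refine Finset.sum_eq_zero fun v _ => if_neg fun hsub => ?_
    obtain ⟨w, hw, hwv⟩ := Finset.exists_mem_ne hb v
    have := hsub (Finset.mem_erase.mpr ⟨hwv, Finset.mem_union_right _ hw⟩)
    rcases Finset.mem_union.mp this with h | h
    · exact Finset.disjoint_left.mp hG.1 h hw
    · exact Finset.disjoint_left.mp hab h hw
  · intro hb
    obtain ⟨i, rfl⟩ := Finset.card_eq_one.mp hb
    have : ∀ G, IsSlice Δ a {i} G → l G = coeff (squarefreeExponent a) (D (X i)) := by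
      intro G hG
      have hi : i ∉ G := by simpa using hG.1
      have hia : i ∉ a := by simpa using hab
      have he : (G ∪ {i}).erase i = G := by
        ext v
        by_cases hv : v = i
        · subst hv; simp [hi]
        · simp [hv]
      rw [key G hG, Finset.sum_eq_single i]
      · rw [he, if_pos Finset.subset_union_left, add_tsub_cancel_left]
      · intro v _ hv
        refine if_neg fun hsub => ?_
        have := hsub (Finset.mem_erase.mpr ⟨hv.symm, Finset.mem_union_right _
          (Finset.mem_singleton_self i)⟩)
        simp [hi, hia] at this
      · simp
    intro G G' hG hG'
    rw [this G hG, this G' hG']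

/-- Chosen representatives in `S` of the values of `φ : I_Δ → S/I_Δ` on squarefree monomials. -/
lemma exists_representative
    (φ : Δ.stanleyReisnerIdeal K →ₗ[MvPolynomial V K] _ ⧸ Δ.stanleyReisnerIdeal K) :
    ∃ r : Finset V → MvPolynomial V K,
      (∀ N (hN : N ∉ Δ), φ ⟨_, prod_X_mem_stanleyReisnerIdeal hN⟩ = Ideal.Quotient.mk _ (r N)) ∧
      (∀ A B, Disjoint A B → A ∉ Δ → ∀ m : V →₀ ℕ, m.support ∈ Δ →
        coeff m (r (A ∪ B)) = coeff m (monomial (squarefreeExponent B) 1 * r A)) := by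
  have h : ∀ N, ∃ f : MvPolynomial V K, ∀ hN : N ∉ Δ,
      φ ⟨_, prod_X_mem_stanleyReisnerIdeal hN⟩ = Ideal.Quotient.mk _ f := by
    intro N
    by_cases hN : N ∈ Δ
    · exact ⟨0, fun h => absurd hN h⟩
    · obtain ⟨f, hf⟩ := Ideal.Quotient.mk_surjective (φ ⟨_, prod_X_mem_stanleyReisnerIdeal hN⟩)
      exact ⟨f, fun _ => hf.symm⟩
  choose r hr using h
  refine ⟨r, hr, fun A B hAB hA => ?_⟩
  have hAB' : A ∪ B ∉ Δ := fun h => hA (Δ.lower Finset.subset_union_left h)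
  rw [← mk_eq_mk_iff, ← hr _ hAB', map_mul, ← hr A hA]
  have e : (⟨_, prod_X_mem_stanleyReisnerIdeal hAB'⟩ :
      Δ.stanleyReisnerIdeal K) = (monomial (squarefreeExponent B) (1 : K)) •
        ⟨∏ v ∈ A, X v, prod_X_mem_stanleyReisnerIdeal hA⟩ := by
    ext1
    simp only [Submodule.coe_smul, smul_eq_mul, monomial_squarefreeExponent]
    rw [Finset.prod_union hAB, mul_comm]
  rw [e, map_smul]
  rfl

variable [Fintype V]

/-- The coefficients of `φ` form a cocycle in each multidegree. Those with `b = {i}` are constant,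
so their values assemble into polynomials `g i`, and `x_i ↦ g i` defines the derivation inducing
`φ`. -/
lemma isRigid_of_isRigidAt (h : ∀ a b, Disjoint a b → IsRigidAt K Δ a b) : Δ.IsRigid K := by
  classical
  refine isRigidIdeal_iff.mpr fun φ => ?_
  obtain ⟨r, hr, hrmul⟩ := exists_representative φ
  have hcocycle : ∀ (A : V →₀ ℕ) (b : Finset V), Disjoint A.support b →
      IsCocycle Δ A.support b fun G => coeff (squarefreeExponent G + A) (r (G ∪ b)) := by
    intro A b hAb
    refine ⟨fun G G' hG hG' hGG => ?_, fun G b' hG hb hΔ => ?_⟩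
    · have e1 : G' ∪ b = (G ∪ b) ∪ (G' \ G) := by
        ext v; have := @hGG v; simp; tauto
      have e2 : squarefreeExponent G' + A =
          squarefreeExponent (G' \ G) + (squarefreeExponent G + A) := by
        rw [← add_assoc, ← squarefreeExponent_union Finset.sdiff_disjoint,
          Finset.sdiff_union_of_subset hGG]
      have hd : Disjoint (G ∪ b) (G' \ G) := by
        rw [Finset.disjoint_union_left]
        exact ⟨Finset.disjoint_sdiff, (hG'.1.mono_left Finset.sdiff_subset).symm⟩
      rw [e1, hrmul _ _ hd hG.2.2 _ (by rw [support_squarefreeExponent_add]; exact hG'.2.1), e2,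
        coeff_monomial_mul, one_mul]
    · have e1 : G ∪ b = (G ∪ b') ∪ (b \ b') := by
        ext v; have := @hb.1 v; simp; tauto
      have hd : Disjoint (G ∪ b') (b \ b') := by
        rw [Finset.disjoint_union_left]
        exact ⟨hG.1.mono_right Finset.sdiff_subset, Finset.disjoint_sdiff⟩
      rw [e1, hrmul _ _ hd hΔ _ (by rw [support_squarefreeExponent_add]; exact hG.2.1),
        coeff_monomial_mul', if_neg]
      rw [squarefreeExponent_le_iff, support_squarefreeExponent_add]
      intro hsub
      obtain ⟨v, hv, hv'⟩ := Finset.exists_of_ssubset hb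
      rcases Finset.mem_union.mp (hsub (Finset.mem_sdiff.mpr ⟨hv, hv'⟩)) with h | h
      · exact Finset.disjoint_left.mp hG.1 h hv
      · exact Finset.disjoint_left.mp hAb h hv
  -- The common value of the cocycle of degree `A - e_i`, read off at an arbitrary slice. The
  -- default `0` is harmless: the comparison below only uses `A` with `A i = 0` for which a slice
  -- exists.
  let α : V → (V →₀ ℕ) → K := fun i A =>
    if h : A i = 0 ∧ ∃ G, IsSlice Δ A.support {i} G then
      coeff (squarefreeExponent h.2.choose + A) (r (h.2.choose ∪ {i})) else 0
  have hα0 : ∀ i A, A i ≠ 0 → α i A = 0 := fun i A hA => dif_neg fun h => hA h.1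
  have hα : ∀ i A G, A i = 0 → IsSlice Δ A.support {i} G →
      α i A = coeff (squarefreeExponent G + A) (r (G ∪ {i})) := by
    intro i A G hA hG
    have hd : Disjoint A.support {i} := by simpa using hA
    have hex : A i = 0 ∧ ∃ G, IsSlice Δ A.support {i} G := ⟨hA, G, hG⟩
    simp only [α]
    rw [dif_pos hex]
    exact (h _ _ hd _ (hcocycle A {i} hd)).2 (Finset.card_singleton i) _ _ hex.2.choose_spec hG
  -- The sum is finite: a nonzero `α i A` is a coefficient of one of the finitely many `r (G ∪
  -- {i})`, at the exponent `G + A`.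
  let g : V → MvPolynomial V K := fun i => ∑ A ∈ Finset.univ.biUnion fun G : Finset V =>
    (r (G ∪ {i})).support.image (· - squarefreeExponent G), monomial A (α i A)
  have hg : ∀ i A, coeff A (g i) = α i A := by
    intro i A
    simp only [g, coeff_sum, coeff_monomial, Finset.sum_ite_eq']
    split_ifs with hA
    · rfl
    · by_contra hne
      apply hA
      have hex : A i = 0 ∧ ∃ G, IsSlice Δ A.support {i} G := by
        by_contra hex
        exact hne (show α i A = 0 from dif_neg hex).symm
      obtain ⟨hAi, G, hG⟩ := hex
      rw [hα i A G hAi hG] at hne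
      simp only [Finset.mem_biUnion, Finset.mem_univ, true_and, Finset.mem_image]
      exact ⟨G, _, mem_support_iff.mpr (Ne.symm hne), add_tsub_cancel_left _ _⟩
  refine ⟨mkDerivation K g, ?_⟩
  have hgen : ∀ N (hN : N ∉ Δ), deltaStar K (Δ.stanleyReisnerIdeal K) (mkDerivation K g)
      ⟨_, prod_X_mem_stanleyReisnerIdeal hN⟩ = φ ⟨_, prod_X_mem_stanleyReisnerIdeal hN⟩ := by
    intro N hN
    rw [hr N hN]
    refine mk_eq_mk_iff.mpr fun m hm => ?_
    simp only
    rw [← monomial_squarefreeExponent, coeff_derivation_squarefree]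
    simp only [mkDerivation_X, hg]
    -- The coefficient at `m` of the value on `x_N` has multidegree `A - b` with `b = N \ supp m`,
    -- `G = N ∩ supp m` and `A = m - G`. Here `b` is nonempty because `N` is a non-face and `supp m`
    -- a face.
    set b := N \ m.support with hb
    have hNb : N \ b ⊆ m.support := by
      intro v hv
      simp only [hb, Finset.mem_sdiff] at hv
      tauto
    have hmN : squarefreeExponent (N \ b) + (m - squarefreeExponent (N \ b)) = m :=
      add_tsub_cancel_of_le ((squarefreeExponent_le_iff _ _).mpr hNb)
    have hdis : Disjoint (m - squarefreeExponent (N \ b)).support b := by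
      refine Disjoint.mono_left ?_ (Finset.disjoint_sdiff (s := m.support) (t := N))
      intro v hv
      simp only [Finsupp.mem_support_iff, Finsupp.tsub_apply] at hv ⊢
      omega
    have hN' : N \ b ∪ b = N := Finset.sdiff_union_of_subset Finset.sdiff_subset
    have hslice : IsSlice Δ (m - squarefreeExponent (N \ b)).support b (N \ b) := by
      refine ⟨Finset.sdiff_disjoint, ?_, by rwa [hN']⟩
      rwa [← support_squarefreeExponent_add, hmN]
    have hcard : b.card ≠ 0 := by
      intro h0
      exact hN (Δ.lower (Finset.sdiff_eq_empty_iff_subset.mp (Finset.card_eq_zero.mp h0)) hm)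
    rcases (show b.card = 1 ∨ 1 < b.card by omega) with h1 | h1
    · obtain ⟨i, hi⟩ := Finset.card_eq_one.mp h1
      have hib : i ∈ N ∧ i ∉ m.support := by
        rw [← Finset.mem_sdiff, ← hb, hi]; simp
      rw [Finset.sum_eq_single i]
      · rw [hi] at hslice hNb hmN hN' hdis
        rw [Finset.erase_eq, if_pos hNb, hα i _ _ (by simpa using hdis) hslice, hmN, hN']
      · intro v hv hvi
        split_ifs with hsub
        · exact absurd (hsub (Finset.mem_erase.mpr ⟨hvi.symm, hib.1⟩)) hib.2
        · rfl
      · exact fun h => absurd hib.1 h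
    · have := (h _ _ hdis _ (hcocycle _ b hdis)).1 h1 _ hslice
      simp only [hmN, hN'] at this
      rw [this]
      refine Finset.sum_eq_zero fun v _ => if_neg fun hsub => ?_
      obtain ⟨w, hw, hwv⟩ := Finset.exists_mem_ne h1 v
      exact (Finset.mem_sdiff.mp hw).2
        (hsub (Finset.mem_erase.mpr ⟨hwv, (Finset.mem_sdiff.mp hw).1⟩))
  refine LinearMap.ext fun f => ?_
  obtain ⟨f, hf⟩ := f
  refine Submodule.span_induction (p := fun x hx => deltaStar K (Δ.stanleyReisnerIdeal K)
    (mkDerivation K g) ⟨x, hx⟩ = φ ⟨x, hx⟩) ?_ ?_ ?_ ?_ hf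
  · rintro _ ⟨N, hN, rfl⟩
    exact hgen N hN
  · exact (map_zero _).trans (map_zero φ).symm
  · intro x y hx hy h1 h2
    have := congrArg₂ (· + ·) h1 h2
    simp only [← map_add] at this
    exact this
  · intro s x hx h1
    have := congrArg (s • ·) h1
    simp only [← map_smul] at this
    exact this

/-- `Δ` is rigid iff every cocycle of every multidegree comes from a derivation. -/
theorem isRigid_iff : Δ.IsRigid K ↔ ∀ a b, Disjoint a b → IsRigidAt K Δ a b :=
  ⟨fun h _ _ => h.isRigidAt, isRigid_of_isRigidAt⟩

end StanleyReisner

/-! ## Rigidity of the circ -/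

section Circ

variable {K : Type*} [Field K] {V₁ V₂ : Type*} [DecidableEq V₁] [DecidableEq V₂]
  {Δ₁ : SimplComplex V₁} {Δ₂ : SimplComplex V₂}
  {a₁ b₁ : Finset V₁} {a₂ b₂ : Finset V₂} {f : Finset V₁ → Finset V₂ → K}

omit [DecidableEq V₁] [DecidableEq V₂] in
lemma mem_circ {F : Finset (V₁ ⊕ V₂)} : F ∈ Δ₁.circ Δ₂ ↔ F.toLeft ∈ Δ₁ ∨ F.toRight ∈ Δ₂ :=
  Iff.rfl

/-- `IsSlice` for a circ, in terms of the two components of the sets. -/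
def IsPairSlice (Δ₁ : SimplComplex V₁) (Δ₂ : SimplComplex V₂) (a₁ b₁ : Finset V₁)
    (a₂ b₂ : Finset V₂) (G₁ : Finset V₁) (G₂ : Finset V₂) : Prop :=
  (Disjoint G₁ b₁ ∧ G₁ ∪ b₁ ∉ Δ₁) ∧ (Disjoint G₂ b₂ ∧ G₂ ∪ b₂ ∉ Δ₂) ∧
    (G₁ ∪ a₁ ∈ Δ₁ ∨ G₂ ∪ a₂ ∈ Δ₂)

/-- `IsCocycle` for a circ, in terms of the two components of the sets. -/
structure IsPairCocycle (Δ₁ : SimplComplex V₁) (Δ₂ : SimplComplex V₂) (a₁ b₁ : Finset V₁)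
    (a₂ b₂ : Finset V₂) (f : Finset V₁ → Finset V₂ → K) : Prop where
  mono : ∀ G₁ G₂ G₁' G₂', IsPairSlice Δ₁ Δ₂ a₁ b₁ a₂ b₂ G₁ G₂ →
    IsPairSlice Δ₁ Δ₂ a₁ b₁ a₂ b₂ G₁' G₂' → G₁ ⊆ G₁' → G₂ ⊆ G₂' → f G₁ G₂ = f G₁' G₂'
  boundary : ∀ G₁ G₂ b₁' b₂', IsPairSlice Δ₁ Δ₂ a₁ b₁ a₂ b₂ G₁ G₂ → b₁' ⊆ b₁ → b₂' ⊆ b₂ →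
    (b₁' ≠ b₁ ∨ b₂' ≠ b₂) → G₁ ∪ b₁' ∉ Δ₁ → G₂ ∪ b₂' ∉ Δ₂ → f G₁ G₂ = 0

/-- `IsRigidAt` for a circ, in terms of the two components of the sets. -/
def IsPairRigidAt (K : Type*) [Field K] (Δ₁ : SimplComplex V₁) (Δ₂ : SimplComplex V₂)
    (a₁ b₁ : Finset V₁) (a₂ b₂ : Finset V₂) : Prop :=
  ∀ f : Finset V₁ → Finset V₂ → K, IsPairCocycle Δ₁ Δ₂ a₁ b₁ a₂ b₂ f →
    (1 < b₁.card + b₂.card → ∀ G₁ G₂, IsPairSlice Δ₁ Δ₂ a₁ b₁ a₂ b₂ G₁ G₂ → f G₁ G₂ = 0) ∧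
    (b₁.card + b₂.card = 1 → ∀ G₁ G₂ G₁' G₂', IsPairSlice Δ₁ Δ₂ a₁ b₁ a₂ b₂ G₁ G₂ →
      IsPairSlice Δ₁ Δ₂ a₁ b₁ a₂ b₂ G₁' G₂' → f G₁ G₂ = f G₁' G₂')

lemma IsPairSlice.swap {G₁ : Finset V₁} {G₂ : Finset V₂}
    (h : IsPairSlice Δ₁ Δ₂ a₁ b₁ a₂ b₂ G₁ G₂) : IsPairSlice Δ₂ Δ₁ a₂ b₂ a₁ b₁ G₂ G₁ :=
  ⟨h.2.1, h.1, h.2.2.symm⟩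

lemma IsPairCocycle.swap (h : IsPairCocycle Δ₁ Δ₂ a₁ b₁ a₂ b₂ f) :
    IsPairCocycle Δ₂ Δ₁ a₂ b₂ a₁ b₁ fun G₂ G₁ => f G₁ G₂ :=
  ⟨fun _ _ _ _ hG hG' h₂ h₁ => h.mono _ _ _ _ hG.swap hG'.swap h₁ h₂,
    fun _ _ _ _ hG h₂ h₁ hne hb₂ hb₁ => h.boundary _ _ _ _ hG.swap h₁ h₂ hne.symm hb₁ hb₂⟩

lemma IsPairRigidAt.swap (h : IsPairRigidAt K Δ₁ Δ₂ a₁ b₁ a₂ b₂) :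
    IsPairRigidAt K Δ₂ Δ₁ a₂ b₂ a₁ b₁ := fun _ hf =>
  ⟨fun hb _ _ hG => (h _ hf.swap).1 (by omega) _ _ hG.swap,
    fun hb _ _ _ _ hG hG' => (h _ hf.swap).2 (by omega) _ _ _ _ hG.swap hG'.swap⟩

omit [DecidableEq V₁] [DecidableEq V₂] in
lemma disjoint_iff_toLeft_toRight (A B : Finset (V₁ ⊕ V₂)) :
    Disjoint A B ↔ Disjoint A.toLeft B.toLeft ∧ Disjoint A.toRight B.toRight := by
  simp [Finset.disjoint_left]

lemma isSlice_circ_iff {a b G : Finset (V₁ ⊕ V₂)} :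
    IsSlice (Δ₁.circ Δ₂) a b G ↔
      IsPairSlice Δ₁ Δ₂ a.toLeft b.toLeft a.toRight b.toRight G.toLeft G.toRight := by
  simp only [IsSlice, IsPairSlice, mem_circ, Finset.toLeft_union, Finset.toRight_union,
    disjoint_iff_toLeft_toRight]
  tauto

lemma isCocycle_circ_iff {a b : Finset (V₁ ⊕ V₂)} {l : Finset (V₁ ⊕ V₂) → K} :
    IsCocycle (Δ₁.circ Δ₂) a b l ↔
      IsPairCocycle Δ₁ Δ₂ a.toLeft b.toLeft a.toRight b.toRight fun G₁ G₂ => l (G₁.disjSum G₂) := by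
  constructor
  · intro h
    refine ⟨fun G₁ G₂ G₁' G₂' hG hG' h₁ h₂ => h.mono _ _ ?_ ?_ (Finset.disjSum_mono h₁ h₂),
      fun G₁ G₂ b₁' b₂' hG h₁ h₂ hne hb₁ hb₂ => h.boundary _ (b₁'.disjSum b₂') ?_ ?_ ?_⟩
    · simpa [isSlice_circ_iff] using hG
    · simpa [isSlice_circ_iff] using hG'
    · simpa [isSlice_circ_iff] using hG
    · refine Finset.ssubset_iff_subset_ne.mpr ⟨Finset.disjSum_subset.mpr ⟨h₁, h₂⟩, ?_⟩
      rw [Ne, Finset.disjSum_eq_iff]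
      tauto
    · simpa [mem_circ, Finset.toLeft_union, Finset.toRight_union] using ⟨hb₁, hb₂⟩
  · intro h
    refine ⟨fun G G' hG hG' hGG => ?_, fun G b' hG hb hΔ => ?_⟩
    · have := h.mono _ _ _ _ (isSlice_circ_iff.mp hG) (isSlice_circ_iff.mp hG')
        (Finset.toLeft_subset_toLeft hGG) (Finset.toRight_subset_toRight hGG)
      simpa only [Finset.toLeft_disjSum_toRight] using this
    · rw [mem_circ, Finset.toLeft_union, Finset.toRight_union, not_or] at hΔ
      have := h.boundary _ _ b'.toLeft b'.toRight (isSlice_circ_iff.mp hG)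
        (Finset.toLeft_subset_toLeft hb.1) (Finset.toRight_subset_toRight hb.1) ?_ hΔ.1 hΔ.2
      · simpa only [Finset.toLeft_disjSum_toRight] using this
      · by_contra hne
        push Not at hne
        have := congrArg₂ Finset.disjSum hne.1 hne.2
        rw [Finset.toLeft_disjSum_toRight, Finset.toLeft_disjSum_toRight] at this
        exact hb.ne this

lemma isRigidAt_circ_iff {a b : Finset (V₁ ⊕ V₂)} :
    IsRigidAt K (Δ₁.circ Δ₂) a b ↔
      IsPairRigidAt K Δ₁ Δ₂ a.toLeft b.toLeft a.toRight b.toRight := by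
  constructor
  · intro h f hf
    have := h (fun G => f G.toLeft G.toRight) (isCocycle_circ_iff.mpr (by simpa using hf))
    rw [← Finset.card_toLeft_add_card_toRight] at this
    refine ⟨fun hb G₁ G₂ hG => ?_, fun hb G₁ G₂ G₁' G₂' hG hG' => ?_⟩
    · simpa using this.1 hb (G₁.disjSum G₂) (isSlice_circ_iff.mpr (by simpa using hG))
    · simpa using this.2 hb (G₁.disjSum G₂) (G₁'.disjSum G₂')
        (isSlice_circ_iff.mpr (by simpa using hG)) (isSlice_circ_iff.mpr (by simpa using hG'))
  · intro h l hl
    have := h _ (isCocycle_circ_iff.mp hl)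
    rw [Finset.card_toLeft_add_card_toRight] at this
    refine ⟨fun hb G hG => ?_, fun hb G G' hG hG' => ?_⟩
    · simpa only [Finset.toLeft_disjSum_toRight] using this.1 hb _ _ (isSlice_circ_iff.mp hG)
    · simpa only [Finset.toLeft_disjSum_toRight] using
        this.2 hb _ _ _ _ (isSlice_circ_iff.mp hG) (isSlice_circ_iff.mp hG')

/-! ### Comparing the rigidity of a circ with that of its factors -/

variable [Fintype V₁] [Fintype V₂]

theorem isRigid_circ_iff : (Δ₁.circ Δ₂).IsRigid K ↔ ∀ a₁ b₁ a₂ b₂, Disjoint a₁ b₁ →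
    Disjoint a₂ b₂ → IsPairRigidAt K Δ₁ Δ₂ a₁ b₁ a₂ b₂ := by
  simp only [isRigid_iff, isRigidAt_circ_iff, disjoint_iff_toLeft_toRight]
  constructor
  · intro h a₁ b₁ a₂ b₂ h₁ h₂
    simpa using h (a₁.disjSum a₂) (b₁.disjSum b₂) (by simpa using ⟨h₁, h₂⟩)
  · intro h a b hab
    exact h _ _ _ _ hab.1 hab.2

lemma IsRigid.circ_swap (h : (Δ₁.circ Δ₂).IsRigid K) : (Δ₂.circ Δ₁).IsRigid K :=
  isRigid_circ_iff.mpr fun _ _ _ _ h₂ h₁ => (isRigid_circ_iff.mp h _ _ _ _ h₁ h₂).swap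

/-- With `a₂ = b₂ = ∅`, a pair slice has `G₂ ∉ Δ₂`, so its first component is a slice of `Δ₁`. Hence
a cocycle of `Δ₁` extends constantly in `G₂`, and `G₂ = univ` recovers it. -/
lemma IsRigid.of_circ_left (h : (Δ₁.circ Δ₂).IsRigid K) (h₂ : Finset.univ ∉ Δ₂) :
    Δ₁.IsRigid K := by
  refine isRigid_iff.mpr fun a₁ b₁ hab l hl => ?_
  have hslice : ∀ G₁ G₂, IsPairSlice Δ₁ Δ₂ a₁ b₁ ∅ ∅ G₁ G₂ → IsSlice Δ₁ a₁ b₁ G₁ := by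
    rintro G₁ G₂ ⟨⟨h1, h2⟩, ⟨_, h3⟩, h4⟩
    exact ⟨h1, h4.resolve_right h3, h2⟩
  have hslice' : ∀ G₁, IsSlice Δ₁ a₁ b₁ G₁ →
      IsPairSlice Δ₁ Δ₂ a₁ b₁ ∅ ∅ G₁ Finset.univ := by
    rintro G₁ ⟨h1, h2, h3⟩
    exact ⟨⟨h1, h3⟩, ⟨by simp, by simpa using h₂⟩, Or.inl h2⟩
  have := isRigid_circ_iff.mp h a₁ b₁ ∅ ∅ hab (by simp) (fun G₁ _ => l G₁) ⟨?_, ?_⟩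
  · simp only [Finset.card_empty, add_zero] at this
    exact ⟨fun hb G hG => this.1 hb _ _ (hslice' G hG),
      fun hb G G' hG hG' => this.2 hb _ _ _ _ (hslice' G hG) (hslice' G' hG')⟩
  · intro G₁ G₂ G₁' G₂' hG hG' hGG _
    exact hl.mono _ _ (hslice _ _ hG) (hslice _ _ hG') hGG
  · intro G₁ G₂ b₁' b₂' hG h₁ h₂ hne hb _
    refine hl.boundary _ b₁' (hslice _ _ hG) (Finset.ssubset_iff_subset_ne.mpr ⟨h₁, ?_⟩) hb
    exact hne.resolve_right (not_not.mpr (Finset.subset_empty.mp h₂))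

/-- Some facet of `Δ` is the complement of a vertex. -/
def HasCovertexFacet {V : Type*} [Fintype V] [DecidableEq V] (Δ : SimplComplex V) : Prop :=
  Finset.univ ∉ Δ ∧ ∃ i : V, ({i} : Finset V)ᶜ ∈ Δ

omit [DecidableEq V₂] in
lemma notMem_univ_of_notMem {A : Finset V₂} (h : A ∉ Δ₂) : Finset.univ ∉ Δ₂ :=
  fun hu => h (Δ₂.lower (Finset.subset_univ _) hu)

omit [Fintype V₁] in
/-- A pair cocycle is determined on the slices of the first complex by a cocycle of the latter. -/
lemma IsPairCocycle.rigid_left (hf : IsPairCocycle Δ₁ Δ₂ a₁ b₁ a₂ b₂ f)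
    (h : IsRigidAt K Δ₁ a₁ b₁) :
    (1 < b₁.card → ∀ G₁ G₂, IsSlice Δ₁ a₁ b₁ G₁ → Disjoint G₂ b₂ → G₂ ∪ b₂ ∉ Δ₂ → f G₁ G₂ = 0) ∧
    (b₁.card = 1 → ∀ G₁ G₂ G₁' G₂', IsSlice Δ₁ a₁ b₁ G₁ → IsSlice Δ₁ a₁ b₁ G₁' →
      Disjoint G₂ b₂ → G₂ ∪ b₂ ∉ Δ₂ → Disjoint G₂' b₂ → G₂' ∪ b₂ ∉ Δ₂ →
      f G₁ G₂ = f G₁' G₂') := by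
  by_cases hu : Finset.univ ∈ Δ₂
  · exact ⟨fun _ _ _ _ _ h => absurd hu (notMem_univ_of_notMem h),
      fun _ _ _ _ _ _ _ _ h => absurd hu (notMem_univ_of_notMem h)⟩
  have hslice : ∀ G₁ G₂, IsSlice Δ₁ a₁ b₁ G₁ → Disjoint G₂ b₂ → G₂ ∪ b₂ ∉ Δ₂ →
      IsPairSlice Δ₁ Δ₂ a₁ b₁ a₂ b₂ G₁ G₂ := fun G₁ G₂ h h1 h2 =>
    ⟨⟨h.1, h.2.2⟩, ⟨h1, h2⟩, Or.inl h.2.1⟩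
  have htop : b₂ᶜ ∪ b₂ ∉ Δ₂ := by
    rwa [Finset.union_comm, Finset.union_compl]
  have hdis : Disjoint b₂ᶜ b₂ := disjoint_compl_left
  -- `b₂ᶜ` is the largest admissible `G₂`, so monotonicity removes the dependence on `G₂`.
  have key : ∀ G₁ G₂, IsSlice Δ₁ a₁ b₁ G₁ → Disjoint G₂ b₂ → G₂ ∪ b₂ ∉ Δ₂ →
      f G₁ G₂ = f G₁ b₂ᶜ := fun G₁ G₂ h h1 h2 =>
    hf.mono _ _ _ _ (hslice _ _ h h1 h2) (hslice _ _ h hdis htop) subset_rfl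
      (Finset.subset_compl_iff_disjoint_right.mpr h1)
  have := h (fun G₁ => f G₁ b₂ᶜ) ⟨fun G G' hG hG' hGG => hf.mono _ _ _ _ (hslice _ _ hG hdis htop)
    (hslice _ _ hG' hdis htop) hGG subset_rfl, fun G b' hG hb hΔ => hf.boundary _ _ b' b₂
      (hslice _ _ hG hdis htop) hb.1 subset_rfl (Or.inl hb.ne) hΔ htop⟩
  refine ⟨fun hb G₁ G₂ hG h1 h2 => ?_, fun hb G₁ G₂ G₁' G₂' hG hG' h1 h2 h1' h2' => ?_⟩
  · rw [key _ _ hG h1 h2, this.1 hb _ hG]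
  · rw [key _ _ hG h1 h2, key _ _ hG' h1' h2', this.2 hb _ _ hG hG']

/-- A pair cocycle vanishes on the slices of the first complex, if not both complexes have a facet
that is the complement of a vertex. -/
lemma IsPairCocycle.eq_zero_left (hf : IsPairCocycle Δ₁ Δ₂ a₁ b₁ a₂ b₂ f)
    (h₁ : IsRigidAt K Δ₁ a₁ b₁) (h₂ : IsRigidAt K Δ₂ a₂ b₂) (ha₂ : Disjoint a₂ b₂)
    (hb₁ : b₁.Nonempty) (hb₂ : b₂.Nonempty) (hn : ¬ (HasCovertexFacet Δ₁ ∧ HasCovertexFacet Δ₂))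
    {G₁ : Finset V₁} {G₂ : Finset V₂} (hG₁ : IsSlice Δ₁ a₁ b₁ G₁) (hG₂ : Disjoint G₂ b₂)
    (hG₂' : G₂ ∪ b₂ ∉ Δ₂) : f G₁ G₂ = 0 := by
  have hl := hf.rigid_left h₁
  have hr := hf.swap.rigid_left h₂
  rcases (show 1 < b₁.card ∨ b₁.card = 1 by have := hb₁.card_pos; omega) with hc₁ | hc₁
  · exact hl.1 hc₁ _ _ hG₁ hG₂ hG₂'
  have hu₁ := notMem_univ_of_notMem hG₁.2.2
  have hu₂ := notMem_univ_of_notMem hG₂'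
  have htop₁ : b₁ᶜ ∪ b₁ ∉ Δ₁ := by rwa [Finset.union_comm, Finset.union_compl]
  have htop₂ : b₂ᶜ ∪ b₂ ∉ Δ₂ := by rwa [Finset.union_comm, Finset.union_compl]
  have hdis₁ : Disjoint b₁ᶜ b₁ := disjoint_compl_left
  have hdis₂ : Disjoint b₂ᶜ b₂ := disjoint_compl_left
  rw [hl.2 hc₁ G₁ G₂ G₁ b₂ᶜ hG₁ hG₁ hG₂ hG₂' hdis₂ htop₂]
  -- If `b₂ᶜ` is a non-face, the boundary condition applies with `b₂` shrunk to `∅`. If it is a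
  -- face, `b₂ᶜ` is also a slice of `Δ₂`, so rigidity of `Δ₂` applies and, for `|b₂| = 1`, moves
  -- `G₁` to `b₁ᶜ`; there `b₁` can be shrunk to `∅`, because `b₁ᶜ` and `b₂ᶜ` are not both faces.
  by_cases hT₂ : b₂ᶜ ∈ Δ₂
  · have hs₂ : IsSlice Δ₂ a₂ b₂ b₂ᶜ := by
      refine ⟨hdis₂, ?_, htop₂⟩
      rwa [Finset.union_eq_left.mpr (Finset.subset_compl_iff_disjoint_right.mpr ha₂)]
    rcases (show 1 < b₂.card ∨ b₂.card = 1 by have := hb₂.card_pos; omega) with hc₂ | hc₂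
    · exact hr.1 hc₂ b₂ᶜ G₁ hs₂ hG₁.1 hG₁.2.2
    · rw [hr.2 hc₂ b₂ᶜ G₁ b₂ᶜ b₁ᶜ hs₂ hs₂ hG₁.1 hG₁.2.2 hdis₁ htop₁]
      refine hf.boundary _ _ ∅ b₂ ⟨⟨hdis₁, htop₁⟩, ⟨hdis₂, htop₂⟩, Or.inr hs₂.2.1⟩
        (Finset.empty_subset _) subset_rfl (Or.inl hb₁.ne_empty.symm) ?_ htop₂
      obtain ⟨i, rfl⟩ := Finset.card_eq_one.mp hc₁
      obtain ⟨j, rfl⟩ := Finset.card_eq_one.mp hc₂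
      rw [Finset.union_empty]
      exact fun h => hn ⟨⟨hu₁, i, h⟩, ⟨hu₂, j, hT₂⟩⟩
  · exact hf.boundary _ _ b₁ ∅ ⟨⟨hG₁.1, hG₁.2.2⟩, ⟨hdis₂, htop₂⟩, Or.inl hG₁.2.1⟩ subset_rfl
      (Finset.empty_subset _) (Or.inr hb₂.ne_empty.symm) hG₁.2.2 (by rwa [Finset.union_empty])

-- When `b₂ = ∅`, `G₂` itself is a non-face, so `G₂ ∪ a₂` is one too and every pair slice lies over
-- a slice of `Δ₁`.
omit [Fintype V₁] in
lemma isPairRigidAt_of_isRigidAt_left (h₁ : IsRigidAt K Δ₁ a₁ b₁) :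
    IsPairRigidAt K Δ₁ Δ₂ a₁ b₁ a₂ ∅ := by
  intro f hf
  have hl := hf.rigid_left h₁
  have hslice : ∀ G₁ G₂, IsPairSlice Δ₁ Δ₂ a₁ b₁ a₂ ∅ G₁ G₂ → IsSlice Δ₁ a₁ b₁ G₁ := by
    rintro G₁ G₂ ⟨⟨h1, h2⟩, ⟨_, h3⟩, h4⟩
    refine ⟨h1, h4.resolve_right fun h => h3 (Δ₂.lower ?_ h), h2⟩
    simp
  rw [Finset.card_empty, add_zero]
  exact ⟨fun hb G₁ G₂ hG => hl.1 hb _ _ (hslice _ _ hG) hG.2.1.1 hG.2.1.2,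
    fun hb G₁ G₂ G₁' G₂' hG hG' => hl.2 hb _ _ _ _ (hslice _ _ hG) (hslice _ _ hG')
      hG.2.1.1 hG.2.1.2 hG'.2.1.1 hG'.2.1.2⟩

theorem isRigid_circ_iff_of_isRigid (h₁ : Δ₁.IsRigid K) (h₂ : Δ₂.IsRigid K) :
    (Δ₁.circ Δ₂).IsRigid K ↔ ¬ HasCovertexFacet Δ₁ ∨ ¬ HasCovertexFacet Δ₂ := by
  rw [← not_and_or]
  constructor
  · rintro h ⟨⟨hu₁, i, hi⟩, ⟨hu₂, j, hj⟩⟩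
    have hmem : ∀ G b', G ∩ {i} = ∅ → b' ⊆ {i} → b' ≠ {i} → G ∪ b' ∈ Δ₁ := by
      intro G b' hG hb hne
      rw [(Finset.subset_singleton_iff.mp hb).resolve_right hne, Finset.union_empty]
      exact Δ₁.lower (Finset.subset_compl_iff_disjoint_right.mpr
        (Finset.disjoint_iff_inter_eq_empty.mpr hG)) hi
    have hmem' : ∀ G b', G ∩ {j} = ∅ → b' ⊆ {j} → b' ≠ {j} → G ∪ b' ∈ Δ₂ := by
      intro G b' hG hb hne
      rw [(Finset.subset_singleton_iff.mp hb).resolve_right hne, Finset.union_empty]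
      exact Δ₂.lower (Finset.subset_compl_iff_disjoint_right.mpr
        (Finset.disjoint_iff_inter_eq_empty.mpr hG)) hj
    -- The constant cocycle `1` is the map dividing by `x_i x_j`. Its boundary condition is vacuous,
    -- since every set avoiding `i`, respectively `j`, is a face.
    have := (isRigid_circ_iff.mp h ∅ {i} ∅ {j} (by simp) (by simp) (fun _ _ => 1)
      ⟨fun _ _ _ _ _ _ _ _ => rfl, ?_⟩).1 (by simp) {i}ᶜ {j}ᶜ ?_
    · exact one_ne_zero this
    · rintro G₁ G₂ b₁' b₂' ⟨⟨hd₁, -⟩, ⟨hd₂, -⟩, -⟩ hb₁ hb₂ (hne | hne) h1 h2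
      · exact absurd (hmem _ _ (Finset.disjoint_iff_inter_eq_empty.mp hd₁) hb₁ hne) h1
      · exact absurd (hmem' _ _ (Finset.disjoint_iff_inter_eq_empty.mp hd₂) hb₂ hne) h2
    · refine ⟨⟨disjoint_compl_left, ?_⟩, ⟨disjoint_compl_left, ?_⟩, Or.inl (by simpa using hi)⟩
      · rwa [Finset.union_comm, Finset.union_compl]
      · rwa [Finset.union_comm, Finset.union_compl]
  · intro hn
    refine isRigid_circ_iff.mpr fun a₁ b₁ a₂ b₂ ha₁ ha₂ => ?_
    have hr₁ := h₁.isRigidAt ha₁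
    have hr₂ := h₂.isRigidAt ha₂
    rcases b₂.eq_empty_or_nonempty with rfl | hb₂
    · exact isPairRigidAt_of_isRigidAt_left hr₁
    rcases b₁.eq_empty_or_nonempty with rfl | hb₁
    · exact (isPairRigidAt_of_isRigidAt_left hr₂).swap
    intro f hf
    refine ⟨fun _ G₁ G₂ hG => ?_, fun hb => ?_⟩
    · rcases hG.2.2 with h | h
      · exact hf.eq_zero_left hr₁ hr₂ ha₂ hb₁ hb₂ hn ⟨hG.1.1, h, hG.1.2⟩ hG.2.1.1 hG.2.1.2
      · exact hf.swap.eq_zero_left hr₂ hr₁ ha₁ hb₂ hb₁ (fun h => hn h.symm)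
          ⟨hG.2.1.1, h, hG.2.1.2⟩ hG.1.1 hG.1.2
    · have := hb₁.card_pos
      have := hb₂.card_pos
      omega

end Circ

/-! ## Special links and special localizations -/

section Links

variable {V : Type*} [Fintype V] [DecidableEq V] {Δ : SimplComplex V}

omit [Fintype V] in
lemma mem_link {A : Finset V} {G : Finset {v : V // v ∉ A}} :
    G ∈ Δ.link A ↔ G.map (Function.Embedding.subtype _) ∪ A ∈ Δ := Iff.rfl

lemma IsSpecial.exists_maximal (h : Δ.IsSpecial) : ∃ i : V, Maximal (· ∈ Δ) ({i}ᶜ : Finset V) := by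
  rcases h with ⟨i, hi⟩ | ⟨i, hi⟩
  · exact ⟨i, show {i}ᶜ ∈ Δ.facets by rw [hi]; simp⟩
  · exact ⟨i, show {i}ᶜ ∈ Δ.facets by rw [hi]; simp⟩

/-- Adjoining `F` to a maximal face of the link that misses one vertex gives a face of `Δ` missing
only that vertex. Conversely, the link of a facet `{i}ᶜ` is the complex `{∅}` on the single vertex
`i`, special of the first kind. -/
theorem exists_isSpecial_link_iff : (∃ F ∈ Δ, (Δ.link F).IsSpecial) ↔ HasCovertexFacet Δ := by
  constructor
  · rintro ⟨F, -, h⟩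
    obtain ⟨i, hi, hmax⟩ := h.exists_maximal
    refine ⟨fun hu => ?_, i, Δ.lower ?_ (mem_link.mp hi)⟩
    · have := hmax (y := Finset.univ) (mem_link.mpr (Δ.lower (Finset.subset_univ _) hu))
        (Finset.subset_univ _)
      simpa using this (Finset.mem_univ i)
    · intro v hv
      by_cases hF : v ∈ F
      · simp [hF]
      · simp only [Finset.mem_compl, Finset.mem_singleton] at hv
        simp [hF, Subtype.ext_iff, hv]
  · rintro ⟨hu, i, hi⟩
    refine ⟨{i}ᶜ, hi, Or.inl ⟨⟨i, by simp⟩, ?_⟩⟩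
    have hmem : ∀ G, G ∈ Δ.link {i}ᶜ ↔
        G ⊆ ({⟨i, by simp⟩} : Finset {v // v ∉ ({i}ᶜ : Finset V)})ᶜ := by
      intro G
      rw [mem_link, Finset.subset_compl_iff_disjoint_right, Finset.disjoint_singleton_right]
      constructor
      · intro h hG
        refine hu (Δ.lower (fun v _ => ?_) h)
        by_cases hv : v = i
        · subst hv
          exact Finset.mem_union_left _ (Finset.mem_map.mpr ⟨_, hG, rfl⟩)
        · simp [hv]
      · intro hG
        refine Δ.lower (Finset.union_subset (fun v hv => ?_) subset_rfl) hi
        obtain ⟨w, hw, rfl⟩ := Finset.mem_map.mp hv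
        simp only [Finset.mem_compl, Finset.mem_singleton]
        intro hwi
        exact hG (by convert hw; exact hwi.symm)
    ext G
    simp only [facets, hmem, Set.mem_ofPred_eq, Set.mem_singleton_iff]
    exact ⟨fun h => Finset.Subset.antisymm h.prop (h.le_of_ge subset_rfl h.prop),
      fun h => h ▸ ⟨subset_rfl, fun _ h _ => h⟩⟩

theorem forall_not_isSpecial_link_iff :
    (∀ F ∈ Δ, ¬ (Δ.link F).IsSpecial) ↔ ¬ HasCovertexFacet Δ := by
  rw [← exists_isSpecial_link_iff]
  push Not
  rfl

/-! ### Monomial localizations -/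

variable {K : Type*} [Field K]

omit [Fintype V] in
lemma rename_aeval_localization (F N : Finset V) :
    rename (fun v : {v : V // v ∈ F} => (v : V))
      (aeval (fun v : V => if h : v ∈ F then (X ⟨v, h⟩ : MvPolynomial {v : V // v ∈ F} K) else 1)
        (∏ v ∈ N, X v : MvPolynomial V K)) = ∏ v ∈ N, if v ∈ F then X v else 1 := by
  simp only [map_prod, aeval_X]
  refine Finset.prod_congr rfl fun v _ => ?_
  split_ifs <;> simp

omit [Fintype V] in
lemma map_monomialLocalization (F : Finset V) :
    (monomialLocalization (Δ.stanleyReisnerIdeal K) F).map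
      (rename (fun v : {v : V // v ∈ F} => (v : V)) :
        MvPolynomial {v : V // v ∈ F} K →ₐ[K] MvPolynomial V K) =
      Ideal.span {f | ∃ N, N ∉ Δ ∧ f = ∏ v ∈ N, if v ∈ F then X v else 1} := by
  rw [monomialLocalization, stanleyReisnerIdeal, Ideal.map_span, Ideal.map_span]
  congr 1
  ext f
  constructor
  · rintro ⟨_, ⟨_, ⟨N, hN, rfl⟩, rfl⟩, rfl⟩
    exact ⟨N, hN, rename_aeval_localization F N⟩
  · rintro ⟨N, hN, rfl⟩
    exact ⟨_, ⟨_, ⟨N, hN, rfl⟩, rfl⟩, rename_aeval_localization F N⟩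

/-- A localization inside `(z)` means that every non-face contains `z`, so `{z}ᶜ` is a face, while
`P ≠ 0` rules out the full simplex. Conversely, if `{i}ᶜ` is a facet, localizing at `(x_i)` gives
`(x_i)` itself, with `P = S`. -/
theorem hasSpecialLocalization_iff :
    HasSpecialLocalization (Δ.stanleyReisnerIdeal K) ↔ HasCovertexFacet Δ := by
  simp only [HasSpecialLocalization, map_monomialLocalization]
  constructor
  · rintro ⟨F, z, P, hP, hJ⟩
    refine ⟨fun hu => ?_, z, ?_⟩
    · have hbot : Ideal.span {f : MvPolynomial V K | ∃ N, N ∉ Δ ∧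
          f = ∏ v ∈ N, if v ∈ F then X v else 1} = ⊥ := by
        rw [Ideal.span_eq_bot]
        rintro f ⟨N, hN, -⟩
        exact absurd (Δ.lower (Finset.subset_univ _) hu) hN
      rw [hbot, eq_comm, Ideal.mul_eq_bot, Ideal.span_singleton_eq_bot] at hJ
      have hPbot := hJ.resolve_left (X_ne_zero z)
      rcases hP with ⟨⟨F', ⟨v, hv⟩, rfl⟩, -⟩ | rfl
      · exact X_ne_zero v (Ideal.span_eq_bot.mp hPbot _ ⟨v, hv, rfl⟩ : (X v : MvPolynomial V K) = 0)
      · exact top_ne_bot hPbot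
    · by_contra hz
      have hmem : (∏ v ∈ ({z}ᶜ : Finset V), if v ∈ F then X v else 1 : MvPolynomial V K) ∈
          Ideal.span {X z} := by
        have hle : Ideal.span {X z} * P ≤ Ideal.span {X z} := Ideal.mul_le_left
        exact hle (hJ ▸ Ideal.subset_span ⟨_, hz, rfl⟩)
      obtain ⟨g, hg⟩ := Ideal.mem_span_singleton.mp hmem
      -- Setting `x_z = 0` and all other variables to `1` kills multiples of `x_z`, but not a
      -- product over vertices other than `z`.
      have := congrArg (eval fun v => if v = z then (0 : K) else 1) hg
      rw [map_mul, eval_X, if_pos rfl, zero_mul, map_prod] at this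
      obtain ⟨v, hv, h0⟩ := Finset.prod_eq_zero_iff.mp this
      have hvz : v ≠ z := by simpa using hv
      split_ifs at h0
      · simp [hvz] at h0
      · simp at h0
  · rintro ⟨hu, i, hi⟩
    refine ⟨{i}, i, ⊤, Or.inr rfl, ?_⟩
    rw [Ideal.mul_top]
    apply le_antisymm
    · rw [Ideal.span_le]
      rintro _ ⟨N, hN, rfl⟩
      have hiN : i ∈ N := by
        by_contra hiN
        exact hN (Δ.lower (Finset.subset_compl_iff_disjoint_right.mpr (by simpa using hiN)) hi)
      rw [SetLike.mem_coe, Ideal.mem_span_singleton]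
      have := Finset.dvd_prod_of_mem
        (fun v => if v ∈ ({i} : Finset V) then (X v : MvPolynomial V K) else 1) hiN
      simpa using this
    · rw [Ideal.span_singleton_le_iff_mem]
      refine Ideal.subset_span ⟨Finset.univ, hu, ?_⟩
      simp

omit [DecidableEq V] in
lemma univ_notMem_of_stanleyReisnerIdeal_ne_bot (h : Δ.stanleyReisnerIdeal K ≠ ⊥) :
    Finset.univ ∉ Δ := by
  refine fun hu => h (Ideal.span_eq_bot.mpr ?_)
  rintro f ⟨N, hN, -⟩
  exact absurd (Δ.lower (Finset.subset_univ _) hu) hN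

end Links

/-! ### The Stanley–Reisner ideal of a circ, and the main theorem -/

theorem stanleyReisnerIdeal_circ {K : Type*} [Field K] {V₁ V₂ : Type*}
    (Δ₁ : SimplComplex V₁) (Δ₂ : SimplComplex V₂) :
    (Δ₁.circ Δ₂).stanleyReisnerIdeal K =
      (Δ₁.stanleyReisnerIdeal K).map
          (rename Sum.inl : MvPolynomial V₁ K →ₐ[K] MvPolynomial (V₁ ⊕ V₂) K) *
        (Δ₂.stanleyReisnerIdeal K).map
          (rename Sum.inr : MvPolynomial V₂ K →ₐ[K] MvPolynomial (V₁ ⊕ V₂) K) := by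
  simp only [stanleyReisnerIdeal]
  rw [Ideal.map_span, Ideal.map_span, Ideal.span_mul_span']
  have hprod : ∀ (N₁ : Finset V₁) (N₂ : Finset V₂),
      (∏ v ∈ N₁.disjSum N₂, X v : MvPolynomial (V₁ ⊕ V₂) K) =
        rename Sum.inl (∏ v ∈ N₁, X v : MvPolynomial V₁ K) *
          rename Sum.inr (∏ v ∈ N₂, X v : MvPolynomial V₂ K) := by
    intro N₁ N₂
    simp [Finset.prod_disjSum, map_prod]
  congr 1
  ext f
  constructor
  · rintro ⟨N, hN, rfl⟩
    rw [mem_circ, not_or] at hN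
    refine ⟨_, ⟨_, ⟨_, hN.1, rfl⟩, rfl⟩, _, ⟨_, ⟨_, hN.2, rfl⟩, rfl⟩, ?_⟩
    have := hprod N.toLeft N.toRight
    rw [Finset.toLeft_disjSum_toRight] at this
    exact this.symm
  · rintro ⟨_, ⟨_, ⟨N₁, h₁, rfl⟩, rfl⟩, _, ⟨_, ⟨N₂, h₂, rfl⟩, rfl⟩, rfl⟩
    exact ⟨N₁.disjSum N₂, by simpa [mem_circ] using ⟨h₁, h₂⟩, (hprod N₁ N₂).symm⟩

end SimplComplex

theorem mainTheorem4 {K : Type*} [Field K]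
    {V₁ V₂ : Type*} [Fintype V₁] [DecidableEq V₁] [Fintype V₂] [DecidableEq V₂]
    (Δ₁ : SimplComplex V₁) (Δ₂ : SimplComplex V₂) :
    -- the Stanley-Reisner ideal of the circ is the product of the two (extended) ideals
    ((Δ₁.circ Δ₂).stanleyReisnerIdeal K =
      (Δ₁.stanleyReisnerIdeal K).map
          (rename Sum.inl : MvPolynomial V₁ K →ₐ[K] MvPolynomial (V₁ ⊕ V₂) K) *
        (Δ₂.stanleyReisnerIdeal K).map
          (rename Sum.inr : MvPolynomial V₂ K →ₐ[K] MvPolynomial (V₁ ⊕ V₂) K)) ∧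
    -- (a)
    ((Δ₁.circ Δ₂).IsRigid K → Δ₁.stanleyReisnerIdeal K ≠ ⊥ → Δ₂.stanleyReisnerIdeal K ≠ ⊥ →
      Δ₁.IsRigid K ∧ Δ₂.IsRigid K) ∧
    -- (b)
    (Δ₁.IsRigid K → Δ₂.IsRigid K →
      ((Δ₁.circ Δ₂).IsRigid K ↔
        (∀ F ∈ Δ₁, ¬ (Δ₁.link F).IsSpecial) ∨ (∀ F ∈ Δ₂, ¬ (Δ₂.link F).IsSpecial)) ∧
      ((Δ₁.circ Δ₂).IsRigid K ↔
        ¬ HasSpecialLocalization (Δ₁.stanleyReisnerIdeal K) ∨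
          ¬ HasSpecialLocalization (Δ₂.stanleyReisnerIdeal K)) ∧
      -- the combinatorial and the algebraic condition agree for each of the two complexes
      ((∀ F ∈ Δ₁, ¬ (Δ₁.link F).IsSpecial) ↔
        ¬ HasSpecialLocalization (Δ₁.stanleyReisnerIdeal K)) ∧
      ((∀ F ∈ Δ₂, ¬ (Δ₂.link F).IsSpecial) ↔
        ¬ HasSpecialLocalization (Δ₂.stanleyReisnerIdeal K))) := by
  refine ⟨SimplComplex.stanleyReisnerIdeal_circ Δ₁ Δ₂, fun h h₁ h₂ => ?_, fun h₁ h₂ => ?_⟩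
  · exact ⟨h.of_circ_left (SimplComplex.univ_notMem_of_stanleyReisnerIdeal_ne_bot h₂),
      h.circ_swap.of_circ_left (SimplComplex.univ_notMem_of_stanleyReisnerIdeal_ne_bot h₁)⟩
  · rw [SimplComplex.forall_not_isSpecial_link_iff, SimplComplex.forall_not_isSpecial_link_iff,
      SimplComplex.hasSpecialLocalization_iff, SimplComplex.hasSpecialLocalization_iff]
    exact ⟨SimplComplex.isRigid_circ_iff_of_isRigid h₁ h₂,
      SimplComplex.isRigid_circ_iff_of_isRigid h₁ h₂, Iff.rfl, Iff.rfl⟩
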